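/- Let $G$ be a group. For a tuple $\mathbf m=(m_1,\dots,m_s)$, a $G$-data of type $\mathbf m$ consists of subgroups $H_1,\dots,H_s\le G$ of finite index $[G:H_i]=m_i$ and homomorphisms $f_i:H_i\to G$ ($1\le i\le s$). It is called simple if the subgroup generated by all subgroups $K\le\bigcap_{i=1}^s H_i$ that are normal in $G$ and satisfy $f_i(K)\le K$ for all $i$ is trivial; a group that has a simple data of type $\mathbf m$ is called self-similar of orbit-type $\mathbf m$. For each $i$ put $H_{i,0}=G$, $H_{i,j+1}=\{h\in H_i : f_i(h)\in H_{i,j}\}$ and $H_{\omega_i}=\bigcap_{j\ge 0}H_{i,j}$, and let $H_{\omega_i}\backslash G=\{H_{\omega_i}g : g\in G\}$. Suppose that $G$ is non-torsion (it has an element of infinite order) and is self-similar of orbit-type $(m_1,\dots,m_s)$ through a simple data $(H_i,f_i)_{1\le i\le s}$, and let $m=[G:\bigcap_{i=1}^s H_i]$. Then for every integer $l\ge 1$ the group $$(\mathbb Z^l)^{((H_{\omega_1}\backslash G)\times\cdots\times(H_{\omega_s}\backslash G))}\rtimes G^s$$ is self-similar of orbit-type $$(\underbrace{m^s,\dots,m^s}_{sl\text{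 times}},\underbrace{1,\dots,1}_{l\text{ times}}).$$ Here the normal factor is the direct sum of copies of $\mathbb Z^l$ indexed by the product of the coset spaces (finitely supported functions), and $G^s$ acts on it by permuting the copies through right translation in each component: conjugation $y\mapsto g^{-1}yg$ by $g=(g_1,\dots,g_s)$ moves the copy with index $(H_{\omega_i}a_i)_i$ to the copy with index $(H_{\omega_i}a_ig_i)_i$. -/

import Mathlib

/-- A `G`-data `(𝐦, 𝐇, 𝐅)`, where `𝐦 = (m₁, …, mₛ)`: subgroups `Hᵢ ≤ G` of finite index
`[G : Hᵢ] = mᵢ`, and virtual endomorphisms `fᵢ : Hᵢ → G`. -/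
structure GData (G : Type*) [Group G] {s : ℕ} (m : Fin s → ℕ) where
  /-- the subgroups `Hᵢ` -/
  H : Fin s → Subgroup G
  /-- the virtual endomorphisms `fᵢ` -/
  f : (i : Fin s) → H i →* G
  finiteIndex : ∀ i, (H i).FiniteIndex
  index_eq : ∀ i, (H i).index = m i

namespace GData

variable {G : Type*} [Group G] {s : ℕ} {m : Fin s → ℕ}

/-- The `𝐅`-core: the subgroup generated by all subgroups `K` of `⋂ᵢ Hᵢ` that are normal in `G`
and satisfy `K^{fᵢ} ≤ K` for all `i`. -/
def core (D : GData G m) : Subgroup G :=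
  sSup {K : Subgroup G | K ≤ ⨅ i, D.H i ∧ K.Normal ∧
    ∀ i, (K.subgroupOf (D.H i)).map (D.f i) ≤ K}

/-- The data is simple if its `𝐅`-core is trivial. -/
def IsSimple (D : GData G m) : Prop := D.core = ⊥

/-- The chain `H_{i,0} = G`, `H_{i,j+1} = {h ∈ Hᵢ | h^{fᵢ} ∈ H_{i,j}}`. -/
def chain (D : GData G m) (i : Fin s) : ℕ → Subgroup G
  | 0 => ⊤
  | j + 1 => ((D.chain i j).comap (D.f i)).map (D.H i).subtype

/-- The parabolic subgroup `H_{ωᵢ} = ⋂ⱼ H_{i,j}` of the single virtual endomorphism `fᵢ`. -/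
def parabolic (D : GData G m) (i : Fin s) : Subgroup G := ⨅ j, D.chain i j

end GData

/-- `G` is self-similar of orbit-type `𝐦 = (m₁, …, mₛ)`: it has a simple `G`-data
`(𝐦, 𝐇, 𝐅)`. -/
def IsSelfSimilarOfOrbitType (G : Type*) [Group G] {s : ℕ} (m : Fin s → ℕ) : Prop :=
  ∃ D : GData G m, D.IsSimple

/-- The set `K \ G` of cosets `K g = {k g | k ∈ K}`. -/
abbrev CosetSpace {G : Type*} [Group G] (K : Subgroup G) : Type _ :=
  Quotient (QuotientGroup.rightRel K)

/-- Translation of the cosets `K a`, as a left action: `g` acts by `K a ↦ K a g⁻¹`. -/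
def cosetPerm {G : Type*} [Group G] (K : Subgroup G) : G →* Equiv.Perm (CosetSpace K) :=
  MonoidHom.toHomPerm
    { toFun := fun g => Quotient.map' (fun a => a * g⁻¹) (by
        intro a b h
        rw [QuotientGroup.rightRel_apply] at h ⊢
        simpa [mul_assoc] using h)
      map_one' := by
        funext x
        induction x using Quotient.inductionOn'
        change Quotient.mk'' _ = Quotient.mk'' _
        simp only [inv_one, mul_one]
      map_mul' := by
        intro g h
        funext x
        induction x using Quotient.inductionOn'
        change Quotient.mk'' _ = Quotient.mk'' _
        simp only [mul_inv_rev, mul_assoc] }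

/-- The componentwise action of `G^s` on `(K₁ \ G) × ⋯ × (Kₛ \ G)`. -/
def cosetsPerm {G : Type*} [Group G] {s : ℕ} (K : Fin s → Subgroup G) :
    (Fin s → G) →* Equiv.Perm ((i : Fin s) → CosetSpace (K i)) where
  toFun g := Equiv.piCongrRight fun i => cosetPerm (K i) (g i)
  map_one' := by ext x i; simp
  map_mul' g h := by ext x i; simp

/-- The action of `G^s` on the direct sum `A^{((K₁ \ G) × ⋯ × (Kₛ \ G))}` (finitely supported
functions, written multiplicatively) by permuting the copies of `A`: `g` sends the element
`a` in the copy `x` to the element `a` in the copy `x g⁻¹`. -/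
noncomputable def cosetsAut (A : Type*) [AddCommGroup A] {G : Type*} [Group G] {s : ℕ}
    (K : Fin s → Subgroup G) :
    (Fin s → G) →* MulAut (Multiplicative (((i : Fin s) → CosetSpace (K i)) →₀ A)) where
  toFun g := AddEquiv.toMultiplicative (Finsupp.domCongr (cosetsPerm K g))
  map_one' := by
    refine MulEquiv.ext fun x => Multiplicative.toAdd.injective (Finsupp.ext fun y => ?_)
    rw [map_one]
    rfl
  map_mul' g h := by
    refine MulEquiv.ext fun x => Multiplicative.toAdd.injective (Finsupp.ext fun y => ?_)
    rw [map_mul]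
    rfl

/-- The group `A^{((K₁ \ G) × ⋯ × (Kₛ \ G))} ⋊ G^s`. -/
abbrev CosetWreath (A : Type*) [AddCommGroup A] {G : Type*} [Group G] {s : ℕ}
    (K : Fin s → Subgroup G) : Type _ :=
  Multiplicative (((i : Fin s) → CosetSpace (K i)) →₀ A) ⋊[cosetsAut A K] (Fin s → G)

/-! Write `A = ℤ^l`, `X` for the product of the coset spaces, and fix `c` of infinite order. The
data consists of the maps `wreathTwist` for `t : Fin s`, each repeated `l` times, and of `l` maps
`augPow` of index 1, which read off one coordinate of the sum of `a ∈ A^{(X)}` as an exponent of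
`c`. Let `K` be normal and invariant. The twists feed every coordinate to every `fᵢ`, so simplicity
of `D` makes the projection of `K` to `G^s` trivial (`eq_bot_of_invariant_pi`), and `K` lies in
`A^{(X)}`. By `augPow`, all its elements have sum zero. The shift fixes the base point and
eventually kills the copy at any other point, so the sum of a high iterate is the value at the base
point (`exists_totalSum_iterate_eq`), which therefore vanishes. As `G^s` is transitive on `X`, `K`
is trivial. -/

section CosetAction

variable {G : Type*} [Group G] {s : ℕ}

/-! ### Homomorphisms on coset wreath products. -/

/-- The coset `K g`. -/
def CosetSpace.mk (K : Subgroup G) (g : G) : CosetSpace K := Quotient.mk'' g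

theorem CosetSpace.mk_eq_mk {K : Subgroup G} {a b : G} : mk K a = mk K b ↔ b * a⁻¹ ∈ K := by
  unfold mk
  rw [Quotient.eq'', QuotientGroup.rightRel_apply]

theorem CosetSpace.mk_surjective (K : Subgroup G) : Function.Surjective (mk K) :=
  Quotient.mk''_surjective

theorem cosetsPerm_apply_of_eq_mk {K : Fin s → Subgroup G} (g : Fin s → G)
    {x : (i : Fin s) → CosetSpace (K i)} {i : Fin s} {a : G} (h : x i = CosetSpace.mk (K i) a) :
    cosetsPerm K g x i = CosetSpace.mk (K i) (a * (g i)⁻¹) := by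
  change cosetPerm (K i) (g i) (x i) = _
  rw [h]
  rfl

theorem toAdd_cosetsAut {A : Type*} [AddCommGroup A] (K : Fin s → Subgroup G) (g : Fin s → G)
    (a : Multiplicative (((i : Fin s) → CosetSpace (K i)) →₀ A)) :
    (cosetsAut A K g a).toAdd = Finsupp.domCongr (cosetsPerm K g) a.toAdd := rfl

/-- The homomorphism `(a, g) ↦ (φ a, F g)` defined on `A^{(X)} ⋊ B` for a subgroup `B` of `G^s`. -/
noncomputable def CosetWreath.mapRestrict {A : Type*} [AddCommGroup A] {K : Fin s → Subgroup G}
    (B : Subgroup (Fin s → G))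
    (φ : (((i : Fin s) → CosetSpace (K i)) →₀ A) →+ (((i : Fin s) → CosetSpace (K i)) →₀ A))
    (F : B →* (Fin s → G))
    (hφ : ∀ (g : B) a, φ (Finsupp.domCongr (cosetsPerm K g) a) =
      Finsupp.domCongr (cosetsPerm K (F g)) (φ a)) :
    (B.comap (SemidirectProduct.rightHom : CosetWreath A K →* (Fin s → G))) →* CosetWreath A K where
  toFun k := ⟨.ofAdd (φ k.1.left.toAdd), F ⟨k.1.right, k.2⟩⟩
  map_one' := by
    refine SemidirectProduct.ext ?_ ?_
    · simp
    · exact map_one F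
  map_mul' k k' := by
    refine SemidirectProduct.ext ?_ ?_
    · refine Multiplicative.toAdd.injective ?_
      change φ (k.1.left.toAdd + Finsupp.domCongr (cosetsPerm K k.1.right) k'.1.left.toAdd) =
        φ k.1.left.toAdd + Finsupp.domCongr (cosetsPerm K (F ⟨k.1.right, k.2⟩)) (φ k'.1.left.toAdd)
      rw [map_add, ← hφ]
    · exact map_mul F ⟨k.1.right, k.2⟩ ⟨k'.1.right, k'.2⟩

/-- The sum of all the components of an element of `A^{(X)}`. -/
noncomputable def Finsupp.totalSum (X A : Type*) [AddCommGroup A] : (X →₀ A) →+ A :=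
  Finsupp.liftAddHom fun _ => AddMonoidHom.id A

theorem Finsupp.totalSum_single {X A : Type*} [AddCommGroup A] (x : X) (a : A) :
    Finsupp.totalSum X A (Finsupp.single x a) = a := by
  simp [Finsupp.totalSum]

theorem Finsupp.totalSum_domCongr {X A : Type*} [AddCommGroup A] (e : X ≃ X) (a : X →₀ A) :
    Finsupp.totalSum X A (Finsupp.domCongr e a) = Finsupp.totalSum X A a := by
  induction a using Finsupp.induction_linear with
  | zero => simp
  | add a b ha hb => rw [map_add, map_add, ha, hb, map_add]
  | single x v => simp [Finsupp.totalSum]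

/-- The homomorphism `(a, g) ↦ (0, (c^{aug a}, …, c^{aug a}))`, where `aug a` is the integer
`e (∑ₓ a x)`. -/
noncomputable def CosetWreath.augPow {A : Type*} [AddCommGroup A] (K : Fin s → Subgroup G)
    (e : A →+ ℤ) (c : G) :
    (⊤ : Subgroup (CosetWreath A K)) →* CosetWreath A K :=
  (SemidirectProduct.inr.comp
    { toFun := fun k _ => c ^ e (Finsupp.totalSum _ A k.left.toAdd)
      map_one' := by ext; simp
      map_mul' := fun k k' => by
        funext i
        rw [SemidirectProduct.mul_left, toAdd_mul, toAdd_cosetsAut, map_add,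
          Finsupp.totalSum_domCongr, map_add, zpow_add]
        rfl }).comp (Subgroup.subtype ⊤)

end CosetAction

/-! ### The shift on the product of coset spaces. -/

namespace GData

variable {G : Type*} [Group G] {s : ℕ} {m : Fin s → ℕ} (D : GData G m)

/-- The restriction of `fᵢ` to `⋂ᵢ Hᵢ`. -/
def restrict (i : Fin s) : (⨅ i, D.H i : Subgroup G) →* G :=
  (D.f i).comp (Subgroup.inclusion (iInf_le _ i))

theorem mem_chain_succ_iff (i : Fin s) (n : ℕ) (u : (⨅ i, D.H i : Subgroup G)) :
    (u : G) ∈ D.chain i (n + 1) ↔ D.restrict i u ∈ D.chain i n := by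
  have hu : (u : G) ∈ D.H i := iInf_le D.H i u.2
  constructor
  · rintro ⟨v, hv, hvu⟩
    obtain rfl : v = ⟨u, hu⟩ := Subtype.ext hvu
    exact hv
  · exact fun h => ⟨⟨u, hu⟩, h, rfl⟩

theorem restrict_mem_parabolic (i : Fin s) (u : (⨅ i, D.H i : Subgroup G))
    (hu : (u : G) ∈ D.parabolic i) : D.restrict i u ∈ D.parabolic i := by
  rw [parabolic, Subgroup.mem_iInf] at *
  exact fun n => (D.mem_chain_succ_iff i n u).1 (hu (n + 1))

/-- The product of the coset spaces of the parabolic subgroups. -/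
abbrev Cosets : Type _ := (i : Fin s) → CosetSpace (D.parabolic i)

/-- The points all of whose components are cosets of elements of `⋂ᵢ Hᵢ`. -/
def Liftable (x : D.Cosets) : Prop :=
  ∀ i, ∃ u : (⨅ i, D.H i : Subgroup G), x i = CosetSpace.mk (D.parabolic i) u

open Classical in
/-- The map `(H_{ωᵢ} uᵢ)ᵢ ↦ (H_{ωᵢ} fᵢ(uᵢ))ᵢ` for `uᵢ` in `⋂ᵢ Hᵢ`. -/
noncomputable def shift (x : D.Cosets) : D.Cosets := fun i =>
  -- The `else` value is immaterial: `shiftHom` and `Survives` test `Liftable` first.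
  if h : ∃ u : (⨅ i, D.H i : Subgroup G), x i = CosetSpace.mk (D.parabolic i) u then
    CosetSpace.mk (D.parabolic i) (D.restrict i h.choose) else x i

/-- The choice of `u` does not matter, since `fᵢ` maps the part of `H_{ωᵢ}` inside `⋂ⱼ Hⱼ` into
`H_{ωᵢ}`. -/
theorem shift_apply {x : D.Cosets} {i : Fin s} (u : (⨅ i, D.H i : Subgroup G))
    (h : x i = CosetSpace.mk (D.parabolic i) u) :
    D.shift x i = CosetSpace.mk (D.parabolic i) (D.restrict i u) := by
  have hx : ∃ u : (⨅ i, D.H i : Subgroup G), x i = CosetSpace.mk (D.parabolic i) u := ⟨u, h⟩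
  rw [shift, dif_pos hx, CosetSpace.mk_eq_mk, ← map_inv, ← map_mul]
  exact D.restrict_mem_parabolic i _ (CosetSpace.mk_eq_mk.1 (hx.choose_spec.symm.trans h))

theorem Liftable.cosetsPerm {x : D.Cosets} (hx : D.Liftable x)
    (g : Fin s → (⨅ i, D.H i : Subgroup G)) :
    D.Liftable (cosetsPerm D.parabolic (fun i => g i) x) := fun i => by
  obtain ⟨u, hu⟩ := hx i
  exact ⟨u * (g i)⁻¹, cosetsPerm_apply_of_eq_mk _ hu⟩

theorem liftable_cosetsPerm_iff (x : D.Cosets) (g : Fin s → (⨅ i, D.H i : Subgroup G)) :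
    D.Liftable (cosetsPerm D.parabolic (fun i => g i) x) ↔ D.Liftable x := by
  refine ⟨fun h => ?_, fun h => h.cosetsPerm D g⟩
  have h' := h.cosetsPerm D g⁻¹
  rwa [← Equiv.Perm.mul_apply, ← map_mul,
    show (fun i => (((g⁻¹) i : (⨅ i, D.H i : Subgroup G)) : G)) * (fun i => (g i : G)) = 1 by
      ext; simp, map_one] at h'

theorem shift_cosetsPerm {x : D.Cosets} (hx : D.Liftable x)
    (g : Fin s → (⨅ i, D.H i : Subgroup G)) :
    D.shift (cosetsPerm D.parabolic (fun i => g i) x) =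
      cosetsPerm D.parabolic (fun i => D.restrict i (g i)) (D.shift x) := by
  funext i
  obtain ⟨u, hu⟩ := hx i
  rw [D.shift_apply (u * (g i)⁻¹) (cosetsPerm_apply_of_eq_mk _ hu),
    cosetsPerm_apply_of_eq_mk _ (D.shift_apply u hu), map_mul, map_inv]

open Classical in
/-- The endomorphism of `A^{(X)}` that moves the copy of `A` at a liftable point `x` to the point
`D.shift x` and kills all other copies. -/
noncomputable def shiftHom (A : Type*) [AddCommGroup A] : (D.Cosets →₀ A) →+ (D.Cosets →₀ A) :=
  Finsupp.liftAddHom fun x =>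
    if D.Liftable x then Finsupp.singleAddHom (D.shift x) else 0

variable {A : Type*} [AddCommGroup A]

theorem shiftHom_single_of_liftable {x : D.Cosets} (h : D.Liftable x) (v : A) :
    D.shiftHom A (Finsupp.single x v) = Finsupp.single (D.shift x) v := by
  simp [shiftHom, h]

theorem shiftHom_single_of_not_liftable {x : D.Cosets} (h : ¬ D.Liftable x) (v : A) :
    D.shiftHom A (Finsupp.single x v) = 0 := by
  simp [shiftHom, h]

theorem shiftHom_domCongr (g : Fin s → (⨅ i, D.H i : Subgroup G)) (a : D.Cosets →₀ A) :
    D.shiftHom A (Finsupp.domCongr (cosetsPerm D.parabolic fun i => g i) a) =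
      Finsupp.domCongr (cosetsPerm D.parabolic fun i => D.restrict i (g i)) (D.shiftHom A a) := by
  induction a using Finsupp.induction_linear with
  | zero => simp
  | add a b ha hb => simp only [map_add, ha, hb]
  | single x v =>
    rw [Finsupp.domCongr_apply, Finsupp.equivMapDomain_single]
    by_cases hx : D.Liftable x
    · rw [D.shiftHom_single_of_liftable hx,
        D.shiftHom_single_of_liftable ((D.liftable_cosetsPerm_iff x g).2 hx),
        D.shift_cosetsPerm hx, Finsupp.domCongr_apply, Finsupp.equivMapDomain_single]
    · rw [D.shiftHom_single_of_not_liftable hx,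
        D.shiftHom_single_of_not_liftable (mt (D.liftable_cosetsPerm_iff x g).1 hx), map_zero]

/-! ### Iterating the shift isolates the base point. -/

/-- The points to which `D.shift` applies at least `n` times. -/
def Survives : ℕ → D.Cosets → Prop
  | 0, _ => True
  | n + 1, x => D.Liftable x ∧ Survives n (D.shift x)

theorem Survives.of_succ {n : ℕ} {x : D.Cosets} (h : D.Survives (n + 1) x) : D.Survives n x := by
  induction n generalizing x with
  | zero => trivial
  | succ n ih => exact ⟨h.1, ih h.2⟩

theorem survives_antitone : Antitone D.Survives :=
  antitone_nat_of_succ_le fun _ _ h => Survives.of_succ D h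

/-- Every `H_{i,n}` contains `H_{ωᵢ}`, so the representative `g` may be replaced by one in `⋂ⱼ Hⱼ`,
to which `fᵢ` applies. -/
theorem Survives.mem_chain {n : ℕ} {x : D.Cosets} (h : D.Survives n x) (i : Fin s) {g : G}
    (hg : x i = CosetSpace.mk (D.parabolic i) g) : g ∈ D.chain i n := by
  induction n generalizing x g with
  | zero => exact Subgroup.mem_top g
  | succ n ih =>
    obtain ⟨u, hu⟩ := h.1 i
    have h1 : (u : G) ∈ D.chain i (n + 1) :=
      (D.mem_chain_succ_iff i n u).2 (ih h.2 (D.shift_apply u hu))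
    have h2 : g * (u : G)⁻¹ ∈ D.chain i (n + 1) :=
      iInf_le (D.chain i) (n + 1) (CosetSpace.mk_eq_mk.1 (hu.symm.trans hg))
    simpa using mul_mem h2 h1

/-- The point `(H_{ωᵢ})ᵢ`. -/
def base : D.Cosets := fun i => CosetSpace.mk (D.parabolic i) 1

theorem liftable_base : D.Liftable D.base := fun _ => ⟨1, rfl⟩

theorem shift_base : D.shift D.base = D.base := by
  funext i
  rw [D.shift_apply 1 rfl, map_one]
  rfl

theorem survives_base (n : ℕ) : D.Survives n D.base := by
  induction n with
  | zero => trivial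
  | succ n ih => exact ⟨D.liftable_base, by rwa [D.shift_base]⟩

theorem exists_not_survives {x : D.Cosets} (hx : x ≠ D.base) : ∃ n, ¬ D.Survives n x := by
  contrapose! hx
  funext i
  obtain ⟨g, hg⟩ := CosetSpace.mk_surjective (D.parabolic i) (x i)
  have h : g ∈ D.parabolic i := by
    rw [parabolic, Subgroup.mem_iInf]
    exact fun n => (hx n).mem_chain D i hg.symm
  rw [← hg, base, CosetSpace.mk_eq_mk]
  simpa using h

-- A shifted copy keeps its value and only changes place, which the sum does not see.
open Classical in
theorem totalSum_shiftHom_iterate (n : ℕ) (a : D.Cosets →₀ A) :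
    Finsupp.totalSum _ A ((D.shiftHom A)^[n] a) =
      a.sum fun x v => if D.Survives n x then v else 0 := by
  induction a using Finsupp.induction_linear with
  | zero => simp [iterate_map_zero]
  | add a b ha hb =>
    rw [iterate_map_add, map_add, ha, hb, Finsupp.sum_add_index']
    · simp
    · intro x v w
      split_ifs <;> simp
  | single x v =>
    rw [Finsupp.sum_single_index (by simp)]
    induction n generalizing x with
    | zero => simp [Survives, Finsupp.totalSum_single]
    | succ n ih =>
      rw [Function.iterate_succ_apply]
      by_cases hx : D.Liftable x
      · rw [D.shiftHom_single_of_liftable hx, ih]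
        simp [Survives, hx]
      · rw [D.shiftHom_single_of_not_liftable hx, iterate_map_zero, map_zero]
        simp [Survives, hx]

theorem exists_totalSum_iterate_eq (a : D.Cosets →₀ A) :
    ∃ n, Finsupp.totalSum _ A ((D.shiftHom A)^[n] a) = a D.base := by
  classical
  have h : ∀ x : D.Cosets, ∃ n, x ≠ D.base → ¬ D.Survives n x := fun x => by
    by_cases hx : x = D.base
    · exact ⟨0, fun h => (h hx).elim⟩
    · exact (D.exists_not_survives hx).imp fun _ h _ => h
  choose N hN using h
  -- The support is finite, so one exponent serves all its points.
  refine ⟨a.support.sup N, ?_⟩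
  rw [D.totalSum_shiftHom_iterate, Finsupp.sum, Finset.sum_eq_single D.base]
  · rw [if_pos (D.survives_base _)]
  · intro x hx hne
    exact if_neg fun h => hN x hne (D.survives_antitone (Finset.le_sup hx) x h)
  · intro hx
    rw [Finsupp.notMem_support_iff.1 hx, ite_self]

/-! ### Triviality of invariant normal subgroups. -/

theorem eq_bot_of_isSimple (hD : D.IsSimple) {K : Subgroup G} (hK : K ≤ ⨅ i, D.H i)
    (hn : K.Normal) (hinv : ∀ i (u : (⨅ i, D.H i : Subgroup G)), (u : G) ∈ K → D.restrict i u ∈ K) :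
    K = ⊥ := by
  rw [eq_bot_iff, ← (hD : D.core = ⊥)]
  refine le_sSup ⟨hK, hn, fun i => ?_⟩
  rintro _ ⟨u, hu, rfl⟩
  exact hinv i ⟨u, hK hu⟩ hu

/-- A normal subgroup of `G^s` inside `(⋂ᵢ Hᵢ)^s` that is invariant under all the twisted products
`(uⱼ)ⱼ ↦ (fᵢ(u_{i+t}))ᵢ` is trivial. -/
theorem eq_bot_of_invariant_pi [NeZero s] (hD : D.IsSimple) {N : Subgroup (Fin s → G)}
    (hn : N.Normal) (hN : ∀ g ∈ N, ∀ i, g i ∈ ⨅ i, D.H i)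
    (hinv : ∀ (t : Fin s) (u : Fin s → (⨅ i, D.H i : Subgroup G)), (fun i => (u i : G)) ∈ N →
      (fun i => D.restrict i (u (i + t))) ∈ N) : N = ⊥ := by
  set M : Subgroup G := ⨆ j, N.map (Pi.evalMonoidHom (fun _ : Fin s => G) j)
  have hMH : M ≤ ⨅ i, D.H i := by
    refine iSup_le fun j => ?_
    rintro _ ⟨g, hg, rfl⟩
    exact hN g hg j
  have hMn : M.Normal := by
    have (j : Fin s) : (N.map (Pi.evalMonoidHom (fun _ : Fin s => G) j)).Normal :=
      hn.map _ (Function.surjective_eval j)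
    exact Subgroup.iSup_normal _
  have hle (j : Fin s) (g : Fin s → G) (hg : g ∈ N) : g j ∈ M :=
    le_iSup (fun j => N.map (Pi.evalMonoidHom (fun _ : Fin s => G) j)) j ⟨g, hg, rfl⟩
  have hbot : M = ⊥ := by
    refine D.eq_bot_of_isSimple hD hMH hMn fun i => ?_
    have key : M ≤ (M.comap (D.restrict i)).map (Subgroup.subtype _) := by
      refine iSup_le fun j => ?_
      rintro _ ⟨g, hg, rfl⟩
      refine ⟨⟨g j, hN g hg j⟩, ?_, rfl⟩
      -- As `i + (j - i) = j`, coordinate `i` of this twist is `fᵢ(gⱼ)`.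
      have := hle i _ (hinv (j - i) (fun k => ⟨g k, hN g hg k⟩) hg)
      simpa using this
    intro u hu
    obtain ⟨v, hv, hvu⟩ := key hu
    obtain rfl : v = u := Subtype.ext hvu
    exact hv
  rw [eq_bot_iff]
  intro g hg
  refine funext fun j => ?_
  have := hle j g hg
  rwa [hbot, Subgroup.mem_bot] at this

/-- The domain of the virtual endomorphisms of `A^{(X)} ⋊ G^s` of index `m^s`. -/
def wreathDomain : Subgroup (Fin s → G) := Subgroup.pi Set.univ fun _ => ⨅ i, D.H i

/-- The homomorphism `(uⱼ)ⱼ ↦ (fᵢ(u_{i+t}))ᵢ`. -/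
def twist [NeZero s] (t : Fin s) : D.wreathDomain →* (Fin s → G) where
  toFun u i := D.restrict i ⟨u.1 (i + t), u.2 _ trivial⟩
  map_one' := funext fun i => map_one (D.restrict i)
  map_mul' u v := funext fun i => map_mul (D.restrict i) ⟨u.1 (i + t), u.2 _ trivial⟩
    ⟨v.1 (i + t), v.2 _ trivial⟩

/-- The virtual endomorphism of `A^{(X)} ⋊ G^s` that is `D.twist t` on `G^s`, and `D.shiftHom A`
(if `t = 0`) or trivial (if `t ≠ 0`) on `A^{(X)}`. -/
noncomputable def wreathTwist [NeZero s] (A : Type*) [AddCommGroup A] (t : Fin s) :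
    (D.wreathDomain.comap
      (SemidirectProduct.rightHom : CosetWreath A D.parabolic →* (Fin s → G))) →*
      CosetWreath A D.parabolic :=
  -- Zero is equivariant for every `t`; the shift is used for `t = 0`, where coordinates stay in
  -- place.
  CosetWreath.mapRestrict D.wreathDomain (if t = 0 then D.shiftHom A else 0) (D.twist t) (by
    intro g a
    split_ifs with ht
    · subst ht
      convert D.shiftHom_domCongr (fun i => ⟨g.1 i, g.2 i trivial⟩) a using 4
      funext i
      simp [twist]
    · simp)

theorem eq_bot_of_invariant_wreath [NeZero s] (hD : D.IsSimple) {ι : Type*} (e : ι → A →+ ℤ)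
    (he : ∀ a, (∀ j, e j a = 0) → a = 0) {c : G} (hc : ¬ IsOfFinOrder c)
    {K : Subgroup (CosetWreath A D.parabolic)} (hn : K.Normal)
    (hK : K ≤ D.wreathDomain.comap SemidirectProduct.rightHom)
    (htwist : ∀ t, ∀ k : D.wreathDomain.comap
      (SemidirectProduct.rightHom : CosetWreath A D.parabolic →* (Fin s → G)),
      k.1 ∈ K → D.wreathTwist A t k ∈ K)
    (haug : ∀ j, ∀ k : (⊤ : Subgroup (CosetWreath A D.parabolic)), k.1 ∈ K →
      CosetWreath.augPow D.parabolic (e j) c k ∈ K) : K = ⊥ := by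
  have hright : ∀ k ∈ K, k.right = 1 := by
    have hbot : K.map (SemidirectProduct.rightHom :
        CosetWreath A D.parabolic →* (Fin s → G)) = ⊥ := by
      refine D.eq_bot_of_invariant_pi hD (hn.map _ SemidirectProduct.rightHom_surjective) ?_ ?_
      · rintro _ ⟨k, hk, rfl⟩ i
        exact hK hk i trivial
      · rintro t u ⟨k, hk, hku⟩
        refine ⟨_, htwist t ⟨k, hK hk⟩ hk, ?_⟩
        funext i
        change D.restrict i ⟨k.right (i + t), _⟩ = _
        congr 2
        exact congrFun hku (i + t)
    intro k hk
    have : SemidirectProduct.rightHom k ∈ K.map (SemidirectProduct.rightHom :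
        CosetWreath A D.parabolic →* (Fin s → G)) := ⟨k, hk, rfl⟩
    rwa [hbot, Subgroup.mem_bot] at this
  set L : (D.Cosets →₀ A) → Prop := fun a =>
    (SemidirectProduct.inl (Multiplicative.ofAdd a) : CosetWreath A D.parabolic) ∈ K
  have hsum (a : D.Cosets →₀ A) (ha : L a) : Finsupp.totalSum _ A a = 0 := by
    refine he _ fun j => ?_
    have h1 := hright _ (haug j ⟨_, trivial⟩ ha)
    have h2 : c ^ e j (Finsupp.totalSum _ A a) = 1 := congrFun h1 0
    exact (injective_zpow_iff_not_isOfFinOrder.2 hc) (h2.trans (zpow_zero c).symm)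
  have hshift (a : D.Cosets →₀ A) (ha : L a) : L (D.shiftHom A a) := by
    have h1 := htwist 0 ⟨_, hK ha⟩ ha
    convert h1 using 1
    refine SemidirectProduct.ext ?_ ?_
    · simp [wreathTwist, CosetWreath.mapRestrict]
    · exact (hright _ h1).symm
  have hbase (a : D.Cosets →₀ A) (ha : L a) : a D.base = 0 := by
    obtain ⟨n, hn⟩ := D.exists_totalSum_iterate_eq a
    rw [← hn]
    refine hsum _ ?_
    clear hn
    induction n with
    | zero => exact ha
    | succ n ih =>
      rw [Function.iterate_succ_apply']
      exact hshift _ ih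
  have hzero (a : D.Cosets →₀ A) (ha : L a) : a = 0 := by
    ext x
    choose g hg using fun i => CosetSpace.mk_surjective (D.parabolic i) (x i)
    have h1 : L (Finsupp.domCongr (cosetsPerm D.parabolic g) a) := by
      have := hn.conj_mem _ ha (SemidirectProduct.inr g)
      rw [← map_inv, ← SemidirectProduct.inl_aut] at this
      exact this
    have h2 : cosetsPerm D.parabolic g x = D.base := by
      funext i
      rw [cosetsPerm_apply_of_eq_mk g (hg i).symm, mul_inv_cancel]
      rfl
    have h3 := hbase _ h1
    rwa [Finsupp.domCongr_apply, Finsupp.equivMapDomain_apply, ← h2, Equiv.symm_apply_apply] at h3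
  rw [eq_bot_iff]
  intro k hk
  have hk' : k = SemidirectProduct.inl k.left := SemidirectProduct.ext rfl (hright k hk)
  have h0 : k.left = 1 := hzero k.left.toAdd (by rw [hk'] at hk; exact hk)
  rw [hk', h0, map_one]
  exact one_mem _

end GData

/-! ### Assembling the data. -/

theorem corollary4p2 {G : Type*} [Group G] (hG : ∃ x : G, ¬ IsOfFinOrder x) {s : ℕ} (m' : Fin s → ℕ)
    (D : GData G m') (hD : D.IsSimple) (m : ℕ) (hm : m = (⨅ i, D.H i).index)
    (l : ℕ) (hl : 1 ≤ l) :
    IsSelfSimilarOfOrbitType (CosetWreath (Fin l → ℤ) D.parabolic)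
      (Fin.append (fun _ : Fin (s * l) => m ^ s) (fun _ : Fin l => 1)) := by
  obtain ⟨c, hc⟩ := hG
  have hs : NeZero s := by
    refine ⟨?_⟩
    -- For `s = 0` the empty intersection is `G`, which is then its own core.
    rintro rfl
    have htop : (⊤ : Subgroup G) = ⊥ :=
      D.eq_bot_of_isSimple hD (by simp) inferInstance fun i => i.elim0
    have hc1 : c ∈ (⊥ : Subgroup G) := htop ▸ Subgroup.mem_top c
    exact hc (Subgroup.mem_bot.1 hc1 ▸ IsOfFinOrder.one)
  have hm0 : m ≠ 0 := hm ▸ Subgroup.index_iInf_ne_zero fun i => (D.finiteIndex i).index_ne_zero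
  set W := CosetWreath (Fin l → ℤ) D.parabolic
  let E : Fin (s * l + l) → (H : Subgroup W) × (H →* W) :=
    Fin.append
      -- `q` encodes a pair (twist, copy number); the copy number is ignored.
      (fun q => ⟨_, D.wreathTwist (Fin l → ℤ) (finProdFinEquiv.symm q).1⟩)
      (fun j => ⟨⊤, CosetWreath.augPow D.parabolic (Pi.evalAddMonoidHom (fun _ => ℤ) j) c⟩)
  have hidx (q) : (E q).1.index =
      Fin.append (fun _ : Fin (s * l) => m ^ s) (fun _ : Fin l => 1) q := by
    refine Fin.addCases (fun q => ?_) (fun j => ?_) q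
    · simp only [E, Fin.append_left]
      rw [Subgroup.index_comap_of_surjective _ SemidirectProduct.rightHom_surjective,
        GData.wreathDomain, Subgroup.index_pi]
      simp [hm]
    · simp only [E, Fin.append_right]
      exact Subgroup.index_top
  refine ⟨⟨fun q => (E q).1, fun q => (E q).2, fun q => ⟨?_⟩, hidx⟩, ?_⟩
  · rw [hidx q]
    refine Fin.addCases (fun q => ?_) (fun j => ?_) q
    · simpa only [Fin.append_left] using pow_ne_zero s hm0
    · simp only [Fin.append_right, ne_eq, one_ne_zero, not_false_eq_true]
  · rw [GData.IsSimple, GData.core, sSup_eq_bot]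
    rintro K ⟨hK, hn, hinv⟩
    -- Copy 0 of each twist exists because `1 ≤ l`.
    have hleft (t : Fin s) : E (Fin.castAdd l (finProdFinEquiv (t, ⟨0, hl⟩))) =
        ⟨_, D.wreathTwist (Fin l → ℤ) t⟩ := by
      simp only [E, Fin.append_left]
      rw [Equiv.symm_apply_apply]
    have hright (j : Fin l) : E (Fin.natAdd (s * l) j) =
        ⟨⊤, CosetWreath.augPow D.parabolic (Pi.evalAddMonoidHom (fun _ => ℤ) j) c⟩ := by
      simp [E, Fin.append_right]
    have hinv' (P : (H : Subgroup W) × (H →* W)) (q) (hq : E q = P) :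
        ∀ k : P.1, (k : W) ∈ K → P.2 k ∈ K := by
      subst hq
      exact fun k hk => hinv q ⟨k, hk, rfl⟩
    refine D.eq_bot_of_invariant_wreath hD
      (fun j : Fin l => Pi.evalAddMonoidHom (fun _ => ℤ) j) (fun a ha => funext ha) hc hn ?_
      (fun t => hinv' _ _ (hleft t)) (fun j => hinv' _ _ (hright j))
    have h := hK.trans (iInf_le _ (Fin.castAdd l (finProdFinEquiv (0, ⟨0, hl⟩))))
    dsimp only at h
    rwa [hleft 0] at h
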